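/- Let $M$ be a connected smooth manifold (without boundary, Hausdorff, second countable) with a 2-plectic form $\omega$, i.e. a smooth closed 3-form such that $u\mapsto i_u\omega$ is injective on every tangent space. Let $\mathfrak g$ be a finite-dimensional real Lie algebra and $\mathfrak g\to\mathfrak X(M)$, $x\mapsto v_x$, a Lie algebra morphism such that every $v_x$ is Hamiltonian, i.e. $-i_{v_x}\omega=d\alpha$ for some $\alpha\in\Omega^1(M)$. Let $\mathfrak h[1]\oplus\mathfrak g$ be a minimal Lie 2-algebra extending the Lie bracket of $\mathfrak g$: a finite-dimensional real vector space $\mathfrak h$, a representation $[x,h]=-[h,x]$ of $\mathfrak g$ on $\mathfrak h$, and a trinary bracket $[\cdot,\cdot,\cdot]:\wedge^3\mathfrak g\to\mathfrak h$ which is a 3-cocycle for this representation (the unary bracket is zero). A moment map for $\mathfrak h[1]\oplus\mathfrak g$ is an $L_\infty$-morphism from $\mathfrak h[1]\oplus\mathfrak g$ to the Lie 2-algebra $L_\infty(M,\omega)$ of observables whose first component $f_1$ satisfies $d(f_1(x))=-i_{v_x}\omega$. Explicitly, it consists of linear maps $f_1:\mathfrak g\to\Omega^1(M)$, $f_1:\mathfrak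 h\to C^\infty(M)$, $f_2:\wedge^2\mathfrak g\to C^\infty(M)$ such that for all $x,y,z\in\mathfrak g$, $h\in\mathfrak h$: $$d(f_1(x))=-i_{v_x}\omega,\qquad d(f_1(h))=0,\qquad d(f_2(x,y))=f_1([x,y])-\omega(v_x,v_y,\cdot),\qquad f_1([x,h])=0,$$ $$f_1([x,y,z])+\omega(v_x,v_y,v_z)=f_2(x,[y,z])-f_2(y,[x,z])+f_2(z,[x,y]).$$ Fix $p\in M$, let $\omega_{3p}(x,y,z)=\omega(v_x,v_y,v_z)|_p$, a 3-cocycle of $\mathfrak g$ with trivial real coefficients, and let $\mathbb R[1]\oplus_{-\omega_{3p}}\mathfrak g$ be the minimal Lie 2-algebra given by $\mathfrak g$, the trivial representation $\mathbb R$ and the trinary bracket $-\omega_{3p}$. Assume $[\omega_{3p}]_{\mathfrak g}\neq 0$ in the Chevalley–Eilenberg cohomology $H^3(\mathfrak g)$. 1. If a moment map for $\mathfrak h[1]\oplus\mathfrak g$ exists, then $\mathfrak h[1]\oplus\mathfrak g$ has a quotient which is $L_\infty$-isomorphic to $\mathbb R[1]\oplus_{-\omega_{3p}}\mathfrak g$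 by a morphism that is $\mathrm{Id}_{\mathfrak g}$ on $\mathfrak g$. That is, there are a subrepresentation $K\subseteq\mathfrak h$ and an $L_\infty$-morphism from $(\mathfrak h/K)[1]\oplus\mathfrak g$, with the induced brackets, to $\mathbb R[1]\oplus_{-\omega_{3p}}\mathfrak g$, whose first component is bijective and is the identity on $\mathfrak g$. 2. Conversely, if $H^1(M)=0$ (de Rham cohomology) and $\mathfrak h[1]\oplus\mathfrak g$ has such a quotient, then a moment map for $\mathfrak h[1]\oplus\mathfrak g$ exists. -/

import Mathlib

open scoped Manifold ContDiff

noncomputable section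

namespace TwoPlectic

/-! ### Vector fields and differential forms on a smooth manifold

`M` is a boundaryless smooth manifold modelled on the finite-dimensional real vector space `E`. -/

section Forms

variable (E : Type*) [NormedAddCommGroup E] [NormedSpace ℝ E]
  (M : Type*) [TopologicalSpace M] [ChartedSpace E M]

/-- Smooth vector fields: smooth sections of the tangent bundle. -/
abbrev VectorFields [IsManifold 𝓘(ℝ, E) ∞ M] : Type _ :=
  Cₛ^∞⟮𝓘(ℝ, E); E, (TangentSpace 𝓘(ℝ, E) : M → Type _)⟯

/-- A not necessarily smooth `k`-form: an alternating `k`-linear form on every tangent space. -/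
abbrev RoughForm (k : ℕ) : Type _ :=
  ∀ p : M, TangentSpace 𝓘(ℝ, E) p [⋀^Fin k]→L[ℝ] ℝ

variable {E M}

/-- The local representative of a `k`-form in the preferred chart `φ` at `c`, i.e. the pullback
of the form along `φ⁻¹`. It is meaningful on the open set `(extChartAt 𝓘(ℝ, E) c).target`. -/
def RoughForm.localRep {k : ℕ} (α : RoughForm E M k) (c : M) (y : E) : E [⋀^Fin k]→L[ℝ] ℝ :=
  (α ((extChartAt 𝓘(ℝ, E) c).symm y)).compContinuousLinearMap
    (mfderiv 𝓘(ℝ, E) 𝓘(ℝ, E) (extChartAt 𝓘(ℝ, E) c).symm y)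

variable (E M) in
/-- The space `Ω^k(M)` of smooth `k`-forms: the forms whose representatives in all preferred
charts (they form an atlas) are smooth. -/
def SmoothForm (k : ℕ) : Submodule ℝ (RoughForm E M k) where
  carrier := {α | ∀ c : M, ContDiffOn ℝ ∞ (α.localRep c) (extChartAt 𝓘(ℝ, E) c).target}
  zero_mem' := fun c => by
    have h : RoughForm.localRep (0 : RoughForm E M k) c = fun _ => 0 := by
      funext y; ext m; rfl
    rw [h]; exact contDiffOn_const
  add_mem' := fun {α β} hα hβ c => by
    have h : RoughForm.localRep (α + β) c = fun y => α.localRep c y + β.localRep c y := by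
      funext y; ext m; rfl
    rw [h]; exact (hα c).add (hβ c)
  smul_mem' := fun r α hα c => by
    have h : RoughForm.localRep (r • α) c = fun y => r • α.localRep c y := by
      funext y; ext m; rfl
    rw [h]; exact (hα c).const_smul r

/-- `IsExtDeriv α β` says `d α = β` for `k ≥ 0`: in every preferred chart the representative of
`β` is the exterior derivative of the representative of `α`. -/
def IsExtDeriv {k : ℕ} (α : RoughForm E M k) (β : RoughForm E M (k + 1)) : Prop :=
  ∀ c : M, ∀ y ∈ (extChartAt 𝓘(ℝ, E) c).target, extDeriv (α.localRep c) y = β.localRep c y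

/-- The differential `d f` of a function, evaluated on a tangent vector. -/
def dFun (f : C^∞⟮𝓘(ℝ, E), M; ℝ⟯) (p : M) (u : TangentSpace 𝓘(ℝ, E) p) : ℝ :=
  mfderiv 𝓘(ℝ, E) 𝓘(ℝ, ℝ) f p u

variable (E M) in
/-- `H¹(M) = 0` in de Rham cohomology: every closed smooth 1-form is exact. -/
def FirstDeRhamVanishes : Prop :=
  ∀ α ∈ SmoothForm E M 1, IsExtDeriv α 0 →
    ∃ f : C^∞⟮𝓘(ℝ, E), M; ℝ⟯, ∀ (p : M) (u : TangentSpace 𝓘(ℝ, E) p), dFun f p u = α p ![u]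

/-- `Ω` is a 2-plectic form: a smooth closed 3-form such that `u ↦ i_u Ω` is injective on every
tangent space. -/
structure IsTwoPlectic (Ω : RoughForm E M 3) : Prop where
  smooth : Ω ∈ SmoothForm E M 3
  closed : IsExtDeriv Ω 0
  nondegenerate : ∀ p : M,
    Function.Injective fun u : TangentSpace 𝓘(ℝ, E) p =>
      (fun a b : TangentSpace 𝓘(ℝ, E) p => Ω p ![u, a, b])

variable [IsManifold 𝓘(ℝ, E) ∞ M]

/-- The interior product `i_X Ω`. -/
def interiorProduct (X : VectorFields E M) {k : ℕ} (Ω : RoughForm E M (k + 1)) : RoughForm E M k :=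
  fun p => ContinuousAlternatingMap.curryLeft (E := E) (Ω p) (X p)

theorem interiorProduct_apply (X : VectorFields E M) {k : ℕ} (Ω : RoughForm E M (k + 1)) (p : M)
    (m : Fin k → TangentSpace 𝓘(ℝ, E) p) :
    interiorProduct X Ω p m = Ω p (Matrix.vecCons (X p) m) := rfl

/-- `X` is a Hamiltonian vector field of the 1-form `α`: `d α = - i_X Ω`. -/
def IsHamiltonianVectorFieldOf (Ω : RoughForm E M 3) (X : VectorFields E M)
    (α : RoughForm E M 1) : Prop :=
  IsExtDeriv α (-(interiorProduct X Ω))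

/-- The binary bracket `[α, β]'` of `L_∞(M, Ω)` on Hamiltonian 1-forms `α, β` with Hamiltonian
vector fields `X, Y` is `ζ(2) i(X ∧ Y) Ω = Ω(X, Y, ·)`, as `ζ(2) = 1`; here evaluated at `u`.
It does not depend on the choice of `X, Y`, which are unique by nondegeneracy. -/
def lInftyBracket₂ (Ω : RoughForm E M 3) (X Y : VectorFields E M) (p : M)
    (u : TangentSpace 𝓘(ℝ, E) p) : ℝ :=
  Ω p ![X p, Y p, u]

/-- The trinary bracket `[α, β, γ]'` of `L_∞(M, Ω)` on Hamiltonian 1-forms with Hamiltonian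
vector fields `X, Y, Z` is `ζ(3) i(X ∧ Y ∧ Z) Ω = - Ω(X, Y, Z)`, as `ζ(3) = -1`. -/
def lInftyBracket₃ (Ω : RoughForm E M 3) (X Y Z : VectorFields E M) (p : M) : ℝ :=
  -(Ω p ![X p, Y p, Z p])

end Forms

/-! ### Minimal Lie 2-algebras and their `L_∞`-morphisms -/

section LieTwo

variable (𝔤 : Type*) [LieRing 𝔤] [LieAlgebra ℝ 𝔤] (𝔥 : Type*) [AddCommGroup 𝔥] [Module ℝ 𝔥]

/-- The brackets of a Lie 2-algebra structure with zero unary bracket on `𝔥[1] ⊕ 𝔤`, whose binary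
bracket on `𝔤` is the given Lie bracket: `act x h = [x, h] = -[h, x]` and `tri ![x, y, z] =
[x, y, z]`. -/
structure LieTwoBrackets where
  act : 𝔤 →ₗ[ℝ] 𝔥 →ₗ[ℝ] 𝔥
  tri : 𝔤 [⋀^Fin 3]→ₗ[ℝ] 𝔥

variable {𝔤 𝔥}

/-- The higher Jacobi identities, making the brackets a minimal Lie 2-algebra. (The Jacobi identity
on `𝔤` holds since `𝔤` is a Lie algebra.) -/
structure LieTwoBrackets.IsLieTwoAlgebra (L : LieTwoBrackets 𝔤 𝔥) : Prop where
  rep : ∀ (x y : 𝔤) (h : 𝔥), L.act ⁅x, y⁆ h = L.act x (L.act y h) - L.act y (L.act x h)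
  cocycle : ∀ x y z u : 𝔤,
    L.act x (L.tri ![y, z, u]) - L.act y (L.tri ![x, z, u])
        + L.act z (L.tri ![x, y, u]) - L.act u (L.tri ![x, y, z]) =
      L.tri ![⁅x, y⁆, z, u] + L.tri ![y, ⁅x, z⁆, u] + L.tri ![y, z, ⁅x, u⁆]
        - L.tri ![x, ⁅y, z⁆, u] - L.tri ![x, z, ⁅y, u⁆] + L.tri ![x, y, ⁅z, u⁆]

/-- `ℝ[1] ⊕_c 𝔤`: the trinary bracket is `c`, and `𝔤` acts trivially on `ℝ`. -/
def oneDimExtension (c : 𝔤 [⋀^Fin 3]→ₗ[ℝ] ℝ) : LieTwoBrackets 𝔤 ℝ where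
  act := 0
  tri := c

/-- The quotient of `𝔥[1] ⊕ 𝔤` by the ideal `K[1]`, where `K ⊆ 𝔥` satisfies `[𝔤, K] ⊆ K`: the
graded vector space `(𝔥 / K)[1] ⊕ 𝔤` with the induced brackets. -/
def LieTwoBrackets.quotient (L : LieTwoBrackets 𝔤 𝔥) (K : Submodule ℝ 𝔥)
    (hK : ∀ x : 𝔤, ∀ k ∈ K, L.act x k ∈ K) : LieTwoBrackets 𝔤 (𝔥 ⧸ K) where
  act :=
    { toFun := fun x => K.mapQ K (L.act x) (hK x)
      map_add' := fun x y => by ext k; simp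
      map_smul' := fun r x => by ext k; simp }
  tri := K.mkQ.compAlternatingMap L.tri

theorem LieTwoBrackets.quotient_isLieTwoAlgebra {L : LieTwoBrackets 𝔤 𝔥} (hL : L.IsLieTwoAlgebra)
    (K : Submodule ℝ 𝔥) (hK : ∀ x : 𝔤, ∀ k ∈ K, L.act x k ∈ K) :
    (L.quotient K hK).IsLieTwoAlgebra where
  rep x y h := by
    induction h using Submodule.Quotient.induction_on with
    | _ h => exact congrArg K.mkQ (hL.rep x y h)
  cocycle x y z u := congrArg K.mkQ (hL.cocycle x y z u)

/-- An `L_∞`-morphism between minimal Lie 2-algebras: its first component consists of `f₀` in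
degree `0` and `f₁` in degree `-1`, and `f₂` is its second component. -/
structure LieTwoHom {𝔤' : Type*} [LieRing 𝔤'] [LieAlgebra ℝ 𝔤'] {𝔥' : Type*} [AddCommGroup 𝔥']
    [Module ℝ 𝔥'] (L : LieTwoBrackets 𝔤 𝔥) (L' : LieTwoBrackets 𝔤' 𝔥') where
  f₀ : 𝔤 →ₗ[ℝ] 𝔤'
  f₁ : 𝔥 →ₗ[ℝ] 𝔥'
  f₂ : 𝔤 [⋀^Fin 2]→ₗ[ℝ] 𝔥'
  map_lie : ∀ x y : 𝔤, f₀ ⁅x, y⁆ = ⁅f₀ x, f₀ y⁆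
  map_act : ∀ (x : 𝔤) (h : 𝔥), f₁ (L.act x h) = L'.act (f₀ x) (f₁ h)
  map_tri : ∀ x y z : 𝔤,
    f₁ (L.tri ![x, y, z]) - L'.tri ![f₀ x, f₀ y, f₀ z] =
      f₂ ![x, ⁅y, z⁆] - f₂ ![y, ⁅x, z⁆] + f₂ ![z, ⁅x, y⁆]
        + L'.act (f₀ x) (f₂ ![y, z]) - L'.act (f₀ y) (f₂ ![x, z]) + L'.act (f₀ z) (f₂ ![x, y])

/-- An `L_∞`-isomorphism is an `L_∞`-morphism whose first component is bijective. -/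
structure LieTwoHom.IsIso {𝔤' : Type*} [LieRing 𝔤'] [LieAlgebra ℝ 𝔤'] {𝔥' : Type*}
    [AddCommGroup 𝔥'] [Module ℝ 𝔥'] {L : LieTwoBrackets 𝔤 𝔥} {L' : LieTwoBrackets 𝔤' 𝔥'}
    (F : LieTwoHom L L') : Prop where
  bijective₀ : Function.Bijective F.f₀
  bijective₁ : Function.Bijective F.f₁

/-- `[c]_𝔤 = 0` in the Chevalley–Eilenberg cohomology `H³(𝔤)` with trivial coefficients: `c` is
the Chevalley–Eilenberg differential of a 2-cochain. -/
def IsCECoboundary (c : 𝔤 [⋀^Fin 3]→ₗ[ℝ] ℝ) : Prop :=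
  ∃ η : 𝔤 [⋀^Fin 2]→ₗ[ℝ] ℝ, ∀ x y z : 𝔤,
    c ![x, y, z] = -η ![⁅x, y⁆, z] + η ![⁅x, z⁆, y] - η ![⁅y, z⁆, x]

/-- `L` has a quotient which is `L_∞`-isomorphic to `L'` by a morphism that is the identity
on `𝔤`. Such a quotient has degree-zero component `𝔤`, so it is by an ideal in degree `-1`. -/
def HasQuotientIsoOverId {𝔥' : Type*} [AddCommGroup 𝔥'] [Module ℝ 𝔥'] (L : LieTwoBrackets 𝔤 𝔥)
    (L' : LieTwoBrackets 𝔤 𝔥') : Prop :=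
  ∃ (K : Submodule ℝ 𝔥) (hK : ∀ x : 𝔤, ∀ k ∈ K, L.act x k ∈ K)
    (F : LieTwoHom (L.quotient K hK) L'), F.IsIso ∧ F.f₀ = LinearMap.id

end LieTwo

/-! ### Hamiltonian actions and homotopy moment maps -/

section Moment

variable {E : Type*} [NormedAddCommGroup E] [NormedSpace ℝ E]
  {M : Type*} [TopologicalSpace M] [ChartedSpace E M] [IsManifold 𝓘(ℝ, E) ∞ M]
  {𝔤 : Type*} [LieRing 𝔤] [LieAlgebra ℝ 𝔤] {𝔥 : Type*} [AddCommGroup 𝔥] [Module ℝ 𝔥]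

/-- `x ↦ v x` is a Lie algebra morphism from `𝔤` to the vector fields on `M` taking values in
Hamiltonian vector fields. -/
structure IsHamiltonianAction (Ω : RoughForm E M 3) (v : 𝔤 →ₗ[ℝ] VectorFields E M) : Prop where
  map_lie : ∀ (x y : 𝔤) (p : M), v ⁅x, y⁆ p = VectorField.mlieBracket 𝓘(ℝ, E) (v x) (v y) p
  hamiltonian : ∀ x : 𝔤, ∃ α ∈ SmoothForm E M 1, IsHamiltonianVectorFieldOf Ω (v x) α

/-- The 3-cochain `ω_{3p}(x, y, z) = Ω(v_x, v_y, v_z)|_p` on `𝔤`. -/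
def omegaAt (Ω : RoughForm E M 3) (v : 𝔤 →ₗ[ℝ] VectorFields E M) (p : M) :
    𝔤 [⋀^Fin 3]→ₗ[ℝ] ℝ :=
  (Ω p).toAlternatingMap.compLinearMap
    { toFun := fun x => v x p
      map_add' := fun x y => by simp
      map_smul' := fun r x => by simp }

/-- A homotopy moment map for the minimal Lie 2-algebra `L = 𝔥[1] ⊕ 𝔤`: an `L_∞`-morphism from `L`
to `L_∞(M, Ω)`, written out in components `f₁|_𝔤`, `f₁|_𝔥`, `f₂`, such that `d (f₁ x) = -i_{v_x} Ω`.
By that condition `v x` is the Hamiltonian vector field of `f₁ x`, hence the one which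
computes the brackets of `L_∞(M, Ω)`. The brackets of `L_∞(M, Ω)` having an entry in
`C^∞(M)` vanish. -/
structure MomentMap (Ω : RoughForm E M 3) (v : 𝔤 →ₗ[ℝ] VectorFields E M)
    (L : LieTwoBrackets 𝔤 𝔥) where
  f₁𝔤 : 𝔤 →ₗ[ℝ] SmoothForm E M 1
  f₁𝔥 : 𝔥 →ₗ[ℝ] C^∞⟮𝓘(ℝ, E), M; ℝ⟯
  f₂ : 𝔤 [⋀^Fin 2]→ₗ[ℝ] C^∞⟮𝓘(ℝ, E), M; ℝ⟯
  hamiltonian : ∀ x : 𝔤, IsHamiltonianVectorFieldOf Ω (v x) (f₁𝔤 x : RoughForm E M 1)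
  d_f₁𝔥 : ∀ (h : 𝔥) (p : M) (u : TangentSpace 𝓘(ℝ, E) p), dFun (f₁𝔥 h) p u = 0
  d_f₂ : ∀ (x y : 𝔤) (p : M) (u : TangentSpace 𝓘(ℝ, E) p),
    dFun (f₂ ![x, y]) p u =
      (f₁𝔤 ⁅x, y⁆ : RoughForm E M 1) p ![u] - lInftyBracket₂ Ω (v x) (v y) p u
  f₁𝔥_act : ∀ (x : 𝔤) (h : 𝔥), f₁𝔥 (L.act x h) = 0
  f₁𝔥_tri : ∀ (x y z : 𝔤) (p : M),
    f₁𝔥 (L.tri ![x, y, z]) p - lInftyBracket₃ Ω (v x) (v y) (v z) p =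
      f₂ ![x, ⁅y, z⁆] p - f₂ ![y, ⁅x, z⁆] p + f₂ ![z, ⁅x, y⁆] p

end Moment

end TwoPlectic

end

/-!
For a moment map `f`, the functional `h ↦ f₁(h)(p)` on `𝔥` kills `[𝔤, 𝔥]`, and evaluating the last
moment map equation at `p` says that it sends the trinary bracket to `-ω_{3p}` up to the
Chevalley–Eilenberg coboundary of `f₂(·, ·)(p)`. So it cannot vanish when `[ω_{3p}] ≠ 0`; hence it
is onto `ℝ`, and it induces the required isomorphism on the quotient of `𝔥` by its kernel
(`MomentMap.hasQuotientIsoOverId`).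

Conversely an isomorphism `F` from a quotient gives a functional `h ↦ F₁[h]` on `𝔥`, and `f₁` is
defined on `𝔥` as the constant functions with these values, and on `𝔤` by a linear choice of
Hamiltonian 1-forms. For the rest one needs two formulas of Cartan calculus, for vector fields
`X, Y, Z` such that `Ω`, `i_X Ω`, `i_Y Ω`, `i_Z Ω` are closed (equivalently, `L_X Ω = 0` and so on):
* `d (Ω(X, Y, ·)) = -i_{[X, Y]} Ω` (`IsTwoPlectic.isExtDeriv_interiorProduct`);
* `d (Ω(X, Y, Z)) = Ω([X, Y], Z, ·) + Ω(X, [Z, Y], ·) + Ω([Z, X], Y, ·)`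
  (`IsTwoPlectic.mfderiv_apply_three`).

Both are proved in charts, from `L_X Ω = 0` written out with Fréchet derivatives. The first one
makes `f₁([x, y]) - Ω(v_x, v_y, ·)` closed, hence exact by `H¹(M) = 0`. On a connected manifold there is
exactly one primitive with the value `F₂(x, y)` at `p`; by uniqueness these primitives depend on
`x, y` multilinearly and alternatingly (`exists_alternatingMap_primitive`), and give `f₂`. By the
second formula and the Jacobi identity, the difference of the two sides of the last moment map
equation has zero differential, so it suffices to check it at `p`, where it is the equation for `F`
(`IsHamiltonianAction.exists_momentMap`).
-/

open scoped Manifold ContDiff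

namespace TwoPlectic

/-! ### Cartan calculus for 3-forms on a vector space -/

section Flat

variable {E F : Type*} [NormedAddCommGroup E] [NormedSpace ℝ E]
  [NormedAddCommGroup F] [NormedSpace ℝ F] {n : ℕ}

/-- `curryLeft` as a continuous linear map. -/
noncomputable def curryLeftCLM (E F : Type*) [NormedAddCommGroup E] [NormedSpace ℝ E]
    [NormedAddCommGroup F] [NormedSpace ℝ F] (n : ℕ) :
    (E [⋀^Fin (n + 1)]→L[ℝ] F) →L[ℝ] E →L[ℝ] E [⋀^Fin n]→L[ℝ] F :=
  (ContinuousAlternatingMap.curryLeftLI (𝕜 := ℝ) (E := E) (F := F)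
    (n := n)).toContinuousLinearMap

/-- Leibniz rule for the interior product `i_X Ω`. -/
theorem fderiv_curryLeft_apply {Ω : E → E [⋀^Fin (n + 1)]→L[ℝ] F} {X : E → E} {y : E}
    (hΩ : DifferentiableAt ℝ Ω y) (hX : DifferentiableAt ℝ X y) :
    DifferentiableAt ℝ (fun z => (Ω z).curryLeft (X z)) y ∧
    ∀ a : E, fderiv ℝ (fun z => (Ω z).curryLeft (X z)) y a =
      (fderiv ℝ Ω y a).curryLeft (X y) + (Ω y).curryLeft (fderiv ℝ X y a) := by
  have h1 : HasFDerivAt (fun z => curryLeftCLM E F n (Ω z))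
      ((curryLeftCLM E F n) ∘L (fderiv ℝ Ω y)) y :=
    HasFDerivAt.comp (F := E [⋀^Fin (n + 1)]→L[ℝ] F) (G := E →L[ℝ] E [⋀^Fin n]→L[ℝ] F) y
      (curryLeftCLM E F n).hasFDerivAt hΩ.hasFDerivAt
  have h2 : HasFDerivAt (fun z => (Ω z).curryLeft (X z)) _ y := h1.clm_apply hX.hasFDerivAt
  refine ⟨h2.differentiableAt, fun a => ?_⟩
  rw [h2.fderiv, add_comm]
  rfl

theorem contDiffOn_curryLeft_apply {Ω : E → E [⋀^Fin (n + 1)]→L[ℝ] F} {X : E → E} {s : Set E}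
    {r : WithTop ℕ∞} (hΩ : ContDiffOn ℝ r Ω s) (hX : ContDiffOn ℝ r X s) :
    ContDiffOn ℝ r (fun z => (Ω z).curryLeft (X z)) s :=
  have h : ContDiff ℝ r (curryLeftCLM E F n) :=
    ContinuousLinearMap.contDiff (𝕜 := ℝ) (E := E [⋀^Fin (n + 1)]→L[ℝ] F)
      (F := E →L[ℝ] E [⋀^Fin n]→L[ℝ] F) (curryLeftCLM E F n)
  (h.comp_contDiffOn hΩ).clm_apply hX

theorem map_swap₀₁ {k : ℕ} (w : E [⋀^Fin (k + 2)]→L[ℝ] F) (a b : E) (m : Fin k → E) :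
    w (Matrix.vecCons a (Matrix.vecCons b m)) = -w (Matrix.vecCons b (Matrix.vecCons a m)) := by
  refine Eq.trans (congrArg w ?_)
    (w.map_swap (Matrix.vecCons b (Matrix.vecCons a m)) (i := 0) (j := 1) (by simp))
  ext i
  refine Fin.cases ?_ (fun i => Fin.cases ?_ (fun i => ?_) i) i
  · simp
  · simp
  · have h1 : i.succ.succ ≠ (0 : Fin (k + 2)) := Fin.succ_ne_zero _
    have h2 : i.succ.succ ≠ (1 : Fin (k + 2)) := by simp [Fin.ext_iff]
    simp [Equiv.swap_apply_of_ne_of_ne h1 h2]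

theorem map_swap₁₂ {k : ℕ} (w : E [⋀^Fin (k + 3)]→L[ℝ] F) (a b c : E) (m : Fin k → E) :
    w (Matrix.vecCons a (Matrix.vecCons b (Matrix.vecCons c m))) =
      -w (Matrix.vecCons a (Matrix.vecCons c (Matrix.vecCons b m))) :=
  map_swap₀₁ (w.curryLeft a) b c m

section Three

variable {Ω : E → E [⋀^Fin 3]→L[ℝ] ℝ} {y : E}

theorem extDeriv_two_apply {η : E → E [⋀^Fin 2]→L[ℝ] ℝ} (hη : DifferentiableAt ℝ η y) (a b c : E) :
    extDeriv η y ![a, b, c] =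
      fderiv ℝ η y a ![b, c] - fderiv ℝ η y b ![a, c] + fderiv ℝ η y c ![a, b] := by
  rw [extDeriv_apply hη, Fin.sum_univ_three]
  have h0 : Fin.removeNth 0 ![a, b, c] = ![b, c] := by ext i; fin_cases i <;> rfl
  have h1 : Fin.removeNth 1 ![a, b, c] = ![a, c] := by ext i; fin_cases i <;> rfl
  have h2 : Fin.removeNth 2 ![a, b, c] = ![a, b] := by ext i; fin_cases i <;> rfl
  simp [h0, h1, h2, fderiv_continuousAlternatingMap_apply_const_apply, hη]
  ring

theorem extDeriv_one_apply {η : E → E [⋀^Fin 1]→L[ℝ] ℝ} (hη : DifferentiableAt ℝ η y) (a b : E) :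
    extDeriv η y ![a, b] = fderiv ℝ η y a ![b] - fderiv ℝ η y b ![a] := by
  rw [extDeriv_apply hη, Fin.sum_univ_two]
  have h0 : Fin.removeNth 0 ![a, b] = ![b] := by ext i; fin_cases i; rfl
  have h1 : Fin.removeNth 1 ![a, b] = ![a] := by ext i; fin_cases i; rfl
  simp [h0, h1, fderiv_continuousAlternatingMap_apply_const_apply, hη]
  ring

theorem extDeriv_three_apply (hΩ : DifferentiableAt ℝ Ω y) (a b c d : E) :
    extDeriv Ω y ![a, b, c, d] =
      fderiv ℝ Ω y a ![b, c, d] - fderiv ℝ Ω y b ![a, c, d] + fderiv ℝ Ω y c ![a, b, d]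
        - fderiv ℝ Ω y d ![a, b, c] := by
  rw [extDeriv_apply hΩ, Fin.sum_univ_four]
  have h0 : Fin.removeNth 0 ![a, b, c, d] = ![b, c, d] := by ext i; fin_cases i <;> rfl
  have h1 : Fin.removeNth 1 ![a, b, c, d] = ![a, c, d] := by ext i; fin_cases i <;> rfl
  have h2 : Fin.removeNth 2 ![a, b, c, d] = ![a, b, d] := by ext i; fin_cases i <;> rfl
  have h3 : Fin.removeNth 3 ![a, b, c, d] = ![a, b, c] := by ext i; fin_cases i <;> rfl
  simp [h0, h1, h2, h3, fderiv_continuousAlternatingMap_apply_const_apply, hΩ]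
  ring

/-- Cartan's formula `L_X Ω = d i_X Ω + i_X dΩ`: if `Ω` and `i_X Ω` are closed, the Lie derivative
of `Ω` along `X` vanishes. -/
theorem lieDerivative_eq_zero (hΩ : DifferentiableAt ℝ Ω y) {X : E → E}
    (hX : DifferentiableAt ℝ X y) (hc : extDeriv Ω y = 0)
    (hXc : extDeriv (fun z => (Ω z).curryLeft (X z)) y = 0) (a b c : E) :
    fderiv ℝ Ω y (X y) ![a, b, c] + Ω y ![fderiv ℝ X y a, b, c] + Ω y ![a, fderiv ℝ X y b, c]
      + Ω y ![a, b, fderiv ℝ X y c] = 0 := by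
  obtain ⟨h1, h2⟩ := fderiv_curryLeft_apply hΩ hX
  have e1 := extDeriv_two_apply h1 a b c
  have e2 := extDeriv_three_apply hΩ (X y) a b c
  rw [hXc] at e1
  rw [hc] at e2
  simp only [h2, ContinuousAlternatingMap.add_apply,
    ContinuousAlternatingMap.curryLeft_apply_apply, ContinuousAlternatingMap.coe_zero,
    Pi.zero_apply] at e1 e2
  have s1 := map_swap₀₁ (Ω y) a (fderiv ℝ X y b) ![c]
  have s2 := map_swap₁₂ (Ω y) a b (fderiv ℝ X y c) ![]
  have s3 := map_swap₀₁ (Ω y) a (fderiv ℝ X y c) ![b]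
  linarith

variable {X Y Z : E → E}

/-- `d (Ω(X, Y, ·)) = -i_{[X, Y]} Ω` if `Ω`, `i_X Ω` and `i_Y Ω` are closed. -/
theorem extDeriv_curryLeft_curryLeft (hΩ : DifferentiableAt ℝ Ω y)
    (hX : DifferentiableAt ℝ X y) (hY : DifferentiableAt ℝ Y y) (hc : extDeriv Ω y = 0)
    (hXc : extDeriv (fun z => (Ω z).curryLeft (X z)) y = 0)
    (hYc : extDeriv (fun z => (Ω z).curryLeft (Y z)) y = 0) :
    extDeriv (fun z => ((Ω z).curryLeft (X z)).curryLeft (Y z)) y =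
      -(Ω y).curryLeft (VectorField.lieBracket ℝ X Y y) := by
  obtain ⟨h1, h2⟩ := fderiv_curryLeft_apply hΩ hX
  obtain ⟨h3, h4⟩ := fderiv_curryLeft_apply h1 hY
  ext m
  obtain ⟨a, b, rfl⟩ : ∃ a b, m = ![a, b] := ⟨m 0, m 1, by ext i; fin_cases i <;> rfl⟩
  have e1 := extDeriv_one_apply h3 a b
  have e2 := extDeriv_three_apply hΩ (X y) (Y y) a b
  have lX := lieDerivative_eq_zero hΩ hX hc hXc (Y y) a b
  have lY := lieDerivative_eq_zero hΩ hY hc hYc (X y) a b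
  have eb : Ω y ![VectorField.lieBracket ℝ X Y y, a, b] =
      Ω y ![fderiv ℝ Y y (X y), a, b] - Ω y ![fderiv ℝ X y (Y y), a, b] := by
    simp only [← ContinuousAlternatingMap.curryLeft_apply_apply]
    simp [VectorField.lieBracket]
  rw [hc] at e2
  simp only [h4, h2, ContinuousAlternatingMap.add_apply, ContinuousAlternatingMap.neg_apply,
    ContinuousAlternatingMap.curryLeft_apply_apply, ContinuousAlternatingMap.coe_zero,
    Pi.zero_apply] at e1 e2 ⊢
  have s1 := map_swap₀₁ (Ω y) (Y y) (fderiv ℝ X y a) ![b]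
  have s2 := map_swap₁₂ (Ω y) (Y y) a (fderiv ℝ X y b) ![]
  have s3 := map_swap₀₁ (Ω y) (Y y) (fderiv ℝ X y b) ![a]
  have s4 := map_swap₁₂ (Ω y) (X y) a (fderiv ℝ Y y b) ![]
  linarith

/-- Leibniz rule for the function `Ω(X, Y, Z)`. -/
theorem fderiv_apply_three_eq_sum (hΩ : DifferentiableAt ℝ Ω y)
    (hX : DifferentiableAt ℝ X y) (hY : DifferentiableAt ℝ Y y) (hZ : DifferentiableAt ℝ Z y) :
    DifferentiableAt ℝ (fun z => Ω z ![X z, Y z, Z z]) y ∧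
    ∀ u, fderiv ℝ (fun z => Ω z ![X z, Y z, Z z]) y u =
      fderiv ℝ Ω y u ![X y, Y y, Z y] + Ω y ![fderiv ℝ X y u, Y y, Z y]
        + Ω y ![X y, fderiv ℝ Y y u, Z y] + Ω y ![X y, Y y, fderiv ℝ Z y u] := by
  obtain ⟨h1, h2⟩ := fderiv_curryLeft_apply hΩ hX
  obtain ⟨h3, h4⟩ := fderiv_curryLeft_apply h1 hY
  obtain ⟨h5, h6⟩ := fderiv_curryLeft_apply h3 hZ
  let ev : (E [⋀^Fin 0]→L[ℝ] ℝ) →L[ℝ] ℝ := ContinuousAlternatingMap.apply ℝ E ℝ ![]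
  have h7 : HasFDerivAt (fun z => Ω z ![X z, Y z, Z z]) _ y :=
    ev.hasFDerivAt.comp y h5.hasFDerivAt
  refine ⟨h7.differentiableAt, fun u => ?_⟩
  rw [h7.fderiv, ContinuousLinearMap.comp_apply, h6, h4, h2]
  simp [ev]

/-- `d (Ω(X, Y, Z)) = Ω([X, Y], Z, ·) + Ω(X, [Z, Y], ·) + Ω([Z, X], Y, ·)` if `Ω`, `i_X Ω`, `i_Y Ω`
and `i_Z Ω` are closed. -/
theorem fderiv_apply_three (hΩ : DifferentiableAt ℝ Ω y)
    (hX : DifferentiableAt ℝ X y) (hY : DifferentiableAt ℝ Y y) (hZ : DifferentiableAt ℝ Z y)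
    (hc : extDeriv Ω y = 0)
    (hXc : extDeriv (fun z => (Ω z).curryLeft (X z)) y = 0)
    (hYc : extDeriv (fun z => (Ω z).curryLeft (Y z)) y = 0)
    (hZc : extDeriv (fun z => (Ω z).curryLeft (Z z)) y = 0) (u : E) :
    fderiv ℝ (fun z => Ω z ![X z, Y z, Z z]) y u =
      Ω y ![VectorField.lieBracket ℝ X Y y, Z y, u] + Ω y ![X y, VectorField.lieBracket ℝ Z Y y, u]
        + Ω y ![VectorField.lieBracket ℝ Z X y, Y y, u] := by
  -- `dΩ(X, Y, Z, u) = 0` moves `u` out of the derivative of `Ω`, and the vanishing Lie derivatives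
  -- remove the derivatives of `Ω` along `X`, `Y`, `Z`
  rw [(fderiv_apply_three_eq_sum hΩ hX hY hZ).2]
  have e2 := extDeriv_three_apply hΩ (X y) (Y y) (Z y) u
  rw [hc, ContinuousAlternatingMap.coe_zero, Pi.zero_apply] at e2
  have lX := lieDerivative_eq_zero hΩ hX hc hXc (Y y) (Z y) u
  have lY := lieDerivative_eq_zero hΩ hY hc hYc (X y) (Z y) u
  have lZ := lieDerivative_eq_zero hΩ hZ hc hZc (X y) (Y y) u
  have eb (A B : E → E) (a b : E) : Ω y ![VectorField.lieBracket ℝ A B y, a, b] =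
      Ω y ![fderiv ℝ B y (A y), a, b] - Ω y ![fderiv ℝ A y (B y), a, b] := by
    simp only [← ContinuousAlternatingMap.curryLeft_apply_apply]
    simp [VectorField.lieBracket]
  have s0 := map_swap₀₁ (Ω y) (X y) (VectorField.lieBracket ℝ Z Y y) ![u]
  rw [eb] at s0
  rw [eb, eb, s0]
  have s1 := map_swap₀₁ (Ω y) (Y y) (fderiv ℝ X y (Z y)) ![u]
  have s2 := map_swap₁₂ (Ω y) (Y y) (Z y) (fderiv ℝ X y u) ![]
  have s3 := map_swap₀₁ (Ω y) (Y y) (fderiv ℝ X y u) ![Z y]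
  have s4 := map_swap₁₂ (Ω y) (X y) (Z y) (fderiv ℝ Y y u) ![]
  have s5 := map_swap₀₁ (Ω y) (X y) (fderiv ℝ Y y (Z y)) ![u]
  have s6 := map_swap₀₁ (Ω y) (X y) (fderiv ℝ Z y (Y y)) ![u]
  linarith

end Three
end Flat

/-! ### Cartan calculus on a manifold -/

theorem minSmoothness_two_le_infty : minSmoothness ℝ 2 ≤ (∞ : WithTop ℕ∞) := by
  rw [minSmoothness_of_isRCLikeNormedField]
  exact WithTop.coe_le_coe.2 le_top

section Charts

variable {E : Type*} [NormedAddCommGroup E] [NormedSpace ℝ E]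
  {M : Type*} [TopologicalSpace M] [ChartedSpace E M]

theorem RoughForm.localRep_add {k : ℕ} (α β : RoughForm E M k) (c : M) :
    (α + β).localRep c = α.localRep c + β.localRep c := by
  funext y; ext m; rfl

theorem RoughForm.localRep_neg {k : ℕ} (α : RoughForm E M k) (c : M) :
    (-α).localRep c = -α.localRep c := by
  funext y; ext m; rfl

theorem RoughForm.localRep_smul {k : ℕ} (r : ℝ) (α : RoughForm E M k) (c : M) :
    (r • α).localRep c = r • α.localRep c := by
  funext y; ext m; rfl

theorem contDiffAt_localRep {k : ℕ} {α : RoughForm E M k} (hα : α ∈ SmoothForm E M k) {c : M}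
    {y : E} (hy : y ∈ (extChartAt 𝓘(ℝ, E) c).target) : ContDiffAt ℝ ∞ (α.localRep c) y :=
  (hα c).contDiffAt ((isOpen_extChartAt_target c).mem_nhds hy)

theorem differentiableAt_localRep {k : ℕ} {α : RoughForm E M k} (hα : α ∈ SmoothForm E M k) {c : M}
    {y : E} (hy : y ∈ (extChartAt 𝓘(ℝ, E) c).target) : DifferentiableAt ℝ (α.localRep c) y :=
  (contDiffAt_localRep hα hy).differentiableAt (by simp)

theorem IsExtDeriv.add {k : ℕ} {α α' : RoughForm E M k} {β β' : RoughForm E M (k + 1)}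
    (hα : α ∈ SmoothForm E M k) (hα' : α' ∈ SmoothForm E M k)
    (h : IsExtDeriv α β) (h' : IsExtDeriv α' β') : IsExtDeriv (α + α') (β + β') := fun c y hy => by
  rw [RoughForm.localRep_add, RoughForm.localRep_add, extDeriv_add
    (differentiableAt_localRep hα hy) (differentiableAt_localRep hα' hy), h c y hy, h' c y hy]
  rfl

theorem IsExtDeriv.smul {k : ℕ} {α : RoughForm E M k} {β : RoughForm E M (k + 1)} (r : ℝ)
    (h : IsExtDeriv α β) : IsExtDeriv (r • α) (r • β) := fun c y hy => by
  rw [RoughForm.localRep_smul, RoughForm.localRep_smul, extDeriv_smul, h c y hy]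
  rfl

/-- `d ∘ d = 0`. -/
theorem IsExtDeriv.extDeriv_localRep_eq_zero {k : ℕ} {α : RoughForm E M k}
    {β : RoughForm E M (k + 1)} (hα : α ∈ SmoothForm E M k) (h : IsExtDeriv α β) {c : M} {y : E}
    (hy : y ∈ (extChartAt 𝓘(ℝ, E) c).target) : extDeriv (β.localRep c) y = 0 := by
  have he : β.localRep c =ᶠ[nhds y] extDeriv (α.localRep c) := by
    filter_upwards [(isOpen_extChartAt_target c).mem_nhds hy] with z hz using (h c z hz).symm
  rw [he.extDeriv_eq]
  exact extDeriv_extDeriv_apply (contDiffAt_localRep hα hy) minSmoothness_two_le_infty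

theorem RoughForm.swap_left (Ω : RoughForm E M 3) (q : M) (a b c : TangentSpace 𝓘(ℝ, E) q) :
    Ω q ![a, b, c] = -Ω q ![b, a, c] :=
  map_swap₀₁ (E := E) (Ω q) a b ![c]

theorem RoughForm.swap_right (Ω : RoughForm E M 3) (q : M) (a b c : TangentSpace 𝓘(ℝ, E) q) :
    Ω q ![a, b, c] = -Ω q ![a, c, b] :=
  map_swap₁₂ (E := E) (Ω q) a b c ![]

theorem IsTwoPlectic.extDeriv_localRep {Ω : RoughForm E M 3}
    (hΩ : IsTwoPlectic Ω) {c : M} {y : E}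
    (hy : y ∈ (extChartAt 𝓘(ℝ, E) c).target) : extDeriv (Ω.localRep c) y = 0 := by
  rw [hΩ.closed c y hy]
  ext m
  rfl

variable [IsManifold 𝓘(ℝ, E) ∞ M]

/-- The representative of a vector field in the preferred chart at `c`. -/
noncomputable def localField (X : VectorFields E M) (c : M) : E → E :=
  VectorField.mpullback 𝓘(ℝ, E) 𝓘(ℝ, E) (extChartAt 𝓘(ℝ, E) c).symm X

/-- Without boundary, the derivative within the range of the model is the full derivative. -/
theorem isInvertible_mfderiv_extChartAt_symm {c : M} {y : E}
    (hy : y ∈ (extChartAt 𝓘(ℝ, E) c).target) :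
    (mfderiv 𝓘(ℝ, E) 𝓘(ℝ, E) (extChartAt 𝓘(ℝ, E) c).symm y).IsInvertible := by
  have h := isInvertible_mfderivWithin_extChartAt_symm (I := 𝓘(ℝ, E)) hy
  rwa [modelWithCornersSelf_coe, Set.range_id, mfderivWithin_univ] at h

theorem mfderiv_extChartAt_symm_localField (X : VectorFields E M) {c : M} {y : E}
    (hy : y ∈ (extChartAt 𝓘(ℝ, E) c).target) :
    mfderiv 𝓘(ℝ, E) 𝓘(ℝ, E) (extChartAt 𝓘(ℝ, E) c).symm y
      (localField (E := E) X c y) =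
      X ((extChartAt 𝓘(ℝ, E) c).symm y) := by
  have h := isInvertible_mfderiv_extChartAt_symm hy
  exact h.self_apply_inverse _

/-- Passing to the chart commutes with interior products, since the derivative of the inverse chart
maps the representative of `X` to `X`. -/
theorem localRep_interiorProduct (X : VectorFields E M) {k : ℕ} (Ω : RoughForm E M (k + 1))
    {c : M} {y : E} (hy : y ∈ (extChartAt 𝓘(ℝ, E) c).target) :
    (interiorProduct X Ω).localRep c y = (Ω.localRep c y).curryLeft (localField X c y) := by
  ext m
  change Ω _ (Matrix.vecCons (X _) _) = Ω _ _
  congr 1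
  rw [← mfderiv_extChartAt_symm_localField X hy]
  ext i
  refine Fin.cases ?_ (fun i => ?_) i <;> rfl

theorem contDiffOn_localField [CompleteSpace E] (X : VectorFields E M) (c : M) :
    ContDiffOn ℝ ∞ (localField X c) (extChartAt 𝓘(ℝ, E) c).target := by
  refine contMDiffOn_vectorSpace_iff_contDiffOn.1 ?_
  intro y hy
  refine (ContMDiffAt.mpullback_vectorField_preimage (n := ∞) (X.contMDiff _)
    ((contMDiffOn_extChartAt_symm c).contMDiffAt ((isOpen_extChartAt_target c).mem_nhds hy))
    (isInvertible_mfderiv_extChartAt_symm hy) (by simp)).contMDiffWithinAt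

theorem differentiableAt_localField [CompleteSpace E] (X : VectorFields E M) {c : M} {y : E}
    (hy : y ∈ (extChartAt 𝓘(ℝ, E) c).target) : DifferentiableAt ℝ (localField X c) y :=
  ((contDiffOn_localField X c).contDiffAt
    ((isOpen_extChartAt_target c).mem_nhds hy)).differentiableAt (by simp)

theorem mlieBracket_eq_lieBracket (V W : (y : E) → TangentSpace 𝓘(ℝ, E) y) (y : E) :
    VectorField.mlieBracket 𝓘(ℝ, E) V W y = VectorField.lieBracket ℝ V W y := by
  rw [← VectorField.mlieBracketWithin_univ, VectorField.mlieBracketWithin_eq_lieBracketWithin]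
  exact congrFun (VectorField.lieBracketWithin_univ (𝕜 := ℝ) (V := V) (W := W)) y

/-- The Lie bracket of vector fields may be computed in any chart. -/
theorem lieBracket_localField [CompleteSpace E] {X Y W : VectorFields E M}
    (hW : ∀ p, W p = VectorField.mlieBracket 𝓘(ℝ, E) X Y p) {c : M} {y : E}
    (hy : y ∈ (extChartAt 𝓘(ℝ, E) c).target) :
    VectorField.lieBracket ℝ (localField X c) (localField Y c) y = localField W c y := by
  have : IsManifold 𝓘(ℝ, E) (minSmoothness ℝ 2) M := .of_le minSmoothness_two_le_infty
  have h := VectorField.mpullback_mlieBracket (I := 𝓘(ℝ, E)) (I' := 𝓘(ℝ, E)) (n := ∞)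
    (V := X) (W := Y) (x₀ := y) (f := (extChartAt 𝓘(ℝ, E) c).symm)
    ((X.contMDiff _).mdifferentiableAt (by simp)) ((Y.contMDiff _).mdifferentiableAt (by simp))
    ((contMDiffOn_extChartAt_symm c).contMDiffAt ((isOpen_extChartAt_target c).mem_nhds hy))
    minSmoothness_two_le_infty
  refine (mlieBracket_eq_lieBracket _ _ y).symm.trans (h.symm.trans ?_)
  simp only [localField, VectorField.mpullback_apply, hW]

theorem interiorProduct_mem_smoothForm [CompleteSpace E] (X : VectorFields E M) {k : ℕ}
    {Ω : RoughForm E M (k + 1)} (hΩ : Ω ∈ SmoothForm E M (k + 1)) :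
    interiorProduct X Ω ∈ SmoothForm E M k := fun c =>
  (contDiffOn_curryLeft_apply (hΩ c) (contDiffOn_localField X c)).congr
    fun _ hy => localRep_interiorProduct X Ω hy

/-- The interior product with a Hamiltonian field is closed, being `-d α`. -/
theorem extDeriv_curryLeft_localField_eq_zero {Ω : RoughForm E M 3} {X : VectorFields E M}
    {α : RoughForm E M 1} (hα : α ∈ SmoothForm E M 1) (h : IsHamiltonianVectorFieldOf Ω X α)
    {c : M} {y : E} (hy : y ∈ (extChartAt 𝓘(ℝ, E) c).target) :
    extDeriv (fun z => (Ω.localRep c z).curryLeft (localField X c z)) y = 0 := by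
  have h1 := IsExtDeriv.extDeriv_localRep_eq_zero hα h hy
  have he : (fun z => (Ω.localRep c z).curryLeft (localField X c z)) =ᶠ[nhds y]
      (-1 : ℝ) • (-(interiorProduct X Ω)).localRep c := by
    filter_upwards [(isOpen_extChartAt_target c).mem_nhds hy] with z hz
    rw [RoughForm.localRep_neg, ← localRep_interiorProduct X Ω hz]
    simp
  rw [he.extDeriv_eq, extDeriv_smul, h1, smul_zero]

/-- `X` is a Hamiltonian vector field for `Ω`: some smooth 1-form `α` satisfies `d α = -i_X Ω`. -/
def IsHamiltonianField (Ω : RoughForm E M 3) (X : VectorFields E M) : Prop :=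
  ∃ α ∈ SmoothForm E M 1, IsHamiltonianVectorFieldOf Ω X α

variable {Ω : RoughForm E M 3} {X Y Z : VectorFields E M}

/-- `d (Ω(X, Y, ·)) = -i_{[X, Y]} Ω` for Hamiltonian `X` and `Y`. -/
theorem IsTwoPlectic.isExtDeriv_interiorProduct [CompleteSpace E] (hΩ : IsTwoPlectic Ω)
    (hX : IsHamiltonianField Ω X) (hY : IsHamiltonianField Ω Y) {W : VectorFields E M}
    (hW : ∀ p, W p = VectorField.mlieBracket 𝓘(ℝ, E) X Y p) :
    IsExtDeriv (interiorProduct Y (interiorProduct X Ω)) (-interiorProduct W Ω) := fun c y hy => by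
  obtain ⟨α, hα, hXα⟩ := hX
  obtain ⟨β, hβ, hYβ⟩ := hY
  have he : (interiorProduct Y (interiorProduct X Ω)).localRep c =ᶠ[nhds y]
      fun z => ((Ω.localRep c z).curryLeft (localField X c z)).curryLeft (localField Y c z) := by
    filter_upwards [(isOpen_extChartAt_target c).mem_nhds hy] with z hz
    rw [localRep_interiorProduct Y _ hz, localRep_interiorProduct X Ω hz]
  rw [he.extDeriv_eq, extDeriv_curryLeft_curryLeft (differentiableAt_localRep hΩ.smooth hy)
    (differentiableAt_localField X hy) (differentiableAt_localField Y hy)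
    (hΩ.extDeriv_localRep hy) (extDeriv_curryLeft_localField_eq_zero hα hXα hy)
    (extDeriv_curryLeft_localField_eq_zero hβ hYβ hy), lieBracket_localField hW hy,
    RoughForm.localRep_neg]
  exact congrArg Neg.neg (localRep_interiorProduct W Ω hy).symm

/-- Transport along an equality of base points; `w` and `u` lie in different tangent spaces, which
are both `E` by definition. -/
theorem apply_congr_point (Ω : RoughForm E M 3) {q q' : M} (h : q' = q) (F G : VectorFields E M)
    (w : TangentSpace 𝓘(ℝ, E) q') (u : TangentSpace 𝓘(ℝ, E) q) (hw : (w : E) = (u : E)) :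
    Ω q' ![F q', G q', w] = Ω q ![F q, G q, u] := by
  subst h
  rw [show w = u from hw]

/-- `d (Ω(X, Y, Z)) = Ω([X, Y], Z, ·) + Ω(X, [Z, Y], ·) + Ω([Z, X], Y, ·)` for Hamiltonian `X`, `Y`
and `Z`. -/
theorem IsTwoPlectic.mfderiv_apply_three [CompleteSpace E] (hΩ : IsTwoPlectic Ω)
    (hX : IsHamiltonianField Ω X) (hY : IsHamiltonianField Ω Y) (hZ : IsHamiltonianField Ω Z)
    {A B C : VectorFields E M}
    (hA : ∀ p, A p = VectorField.mlieBracket 𝓘(ℝ, E) X Y p)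
    (hB : ∀ p, B p = VectorField.mlieBracket 𝓘(ℝ, E) Z Y p)
    (hC : ∀ p, C p = VectorField.mlieBracket 𝓘(ℝ, E) Z X p) (p : M) :
    MDifferentiableAt 𝓘(ℝ, E) 𝓘(ℝ, ℝ) (fun q => Ω q ![X q, Y q, Z q]) p ∧
    ∀ u : TangentSpace 𝓘(ℝ, E) p,
      mfderiv 𝓘(ℝ, E) 𝓘(ℝ, ℝ) (fun q => Ω q ![X q, Y q, Z q]) p u =
        Ω p ![A p, Z p, u] + Ω p ![X p, B p, u] + Ω p ![C p, Y p, u] := by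
  obtain ⟨α, hα, hXα⟩ := hX
  obtain ⟨β, hβ, hYβ⟩ := hY
  obtain ⟨γ, hγ, hZγ⟩ := hZ
  set φ := extChartAt 𝓘(ℝ, E) p
  set g : E → ℝ := fun z =>
    Ω.localRep p z ![localField X p z, localField Y p z, localField Z p z] with hg
  have hy : φ p ∈ φ.target := mem_extChartAt_target p
  have hs : φ.symm (φ p) = p := extChartAt_to_inv p
  -- pulling the contraction back along the chart gives the contraction of the representatives
  have key (F G H : VectorFields E M) (z : E) (hz : z ∈ φ.target) :
      Ω.localRep p z ![localField F p z, localField G p z, localField H p z] =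
        Ω (φ.symm z) ![F (φ.symm z), G (φ.symm z), H (φ.symm z)] := by
    rw [← mfderiv_extChartAt_symm_localField F hz, ← mfderiv_extChartAt_symm_localField G hz,
      ← mfderiv_extChartAt_symm_localField H hz]
    change Ω _ _ = Ω _ _
    congr 1
    ext i; fin_cases i <;> rfl
  obtain ⟨hd, -⟩ := fderiv_apply_three_eq_sum (differentiableAt_localRep hΩ.smooth hy)
    (differentiableAt_localField X hy) (differentiableAt_localField Y hy)
    (differentiableAt_localField Z hy)
  have hd' := fderiv_apply_three (differentiableAt_localRep hΩ.smooth hy)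
    (differentiableAt_localField X hy) (differentiableAt_localField Y hy)
    (differentiableAt_localField Z hy)
    (hΩ.extDeriv_localRep hy) (extDeriv_curryLeft_localField_eq_zero hα hXα hy)
    (extDeriv_curryLeft_localField_eq_zero hβ hYβ hy)
    (extDeriv_curryLeft_localField_eq_zero hγ hZγ hy)
  have hgd : MDifferentiableAt 𝓘(ℝ, E) 𝓘(ℝ, ℝ) g (φ p) := hd.mdifferentiableAt
  have hφ : MDifferentiableAt 𝓘(ℝ, E) 𝓘(ℝ, E) φ p :=
    mdifferentiableAt_extChartAt (mem_chart_source E p)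
  have he : (fun q => Ω q ![X q, Y q, Z q]) =ᶠ[nhds p] g ∘ φ := by
    filter_upwards [extChartAt_source_mem_nhds (I := 𝓘(ℝ, E)) p] with q hq
    have hq' : φ.symm (φ q) = q := φ.left_inv hq
    rw [Function.comp_apply, hg]
    dsimp only
    rw [key X Y Z _ (φ.map_source hq), hq']
  refine ⟨(hgd.comp p hφ).congr_of_eventuallyEq he, fun u => ?_⟩
  rw [he.mfderiv_eq, mfderiv_comp p hgd hφ]
  have hu : mfderiv 𝓘(ℝ, E) 𝓘(ℝ, E) φ.symm (φ p) (mfderiv 𝓘(ℝ, E) 𝓘(ℝ, E) φ p u) = u := by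
    have h := mfderivWithin_extChartAt_symm_comp_mfderiv_extChartAt' (I := 𝓘(ℝ, E))
      (mem_extChartAt_source (I := 𝓘(ℝ, E)) p)
    rw [modelWithCornersSelf_coe, Set.range_id, mfderivWithin_univ] at h
    exact congrArg (fun f => f u) h
  have key' (F G : VectorFields E M) :
      Ω.localRep p (φ p) ![localField F p (φ p), localField G p (φ p),
        mfderiv 𝓘(ℝ, E) 𝓘(ℝ, E) φ p u] = Ω p ![F p, G p, u] := by
    have h1 : Ω.localRep p (φ p) ![localField F p (φ p), localField G p (φ p),
        mfderiv 𝓘(ℝ, E) 𝓘(ℝ, E) φ p u] = Ω (φ.symm (φ p)) ![F (φ.symm (φ p)), G (φ.symm (φ p)),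
          mfderiv 𝓘(ℝ, E) 𝓘(ℝ, E) φ.symm (φ p) (mfderiv 𝓘(ℝ, E) 𝓘(ℝ, E) φ p u)] := by
      rw [← mfderiv_extChartAt_symm_localField F hy, ← mfderiv_extChartAt_symm_localField G hy]
      change Ω _ _ = Ω _ _
      congr 1
      ext i; fin_cases i <;> rfl
    exact h1.trans (apply_congr_point Ω hs F G _ u hu)
  have hg' : mfderiv 𝓘(ℝ, E) 𝓘(ℝ, ℝ) g (φ p) = fderiv ℝ g (φ p) := mfderiv_eq_fderiv
  rw [hg']
  refine (hd' _).trans ?_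
  rw [lieBracket_localField hA hy, lieBracket_localField hB hy, lieBracket_localField hC hy]
  exact congrArg₂ (· + ·) (congrArg₂ (· + ·) (key' A Z) (key' X B)) (key' C Y)

end Charts

/-! ### Primitives on a connected manifold -/

section Global

variable {E : Type*} [NormedAddCommGroup E] [NormedSpace ℝ E]
  {M : Type*} [TopologicalSpace M] [ChartedSpace E M]

theorem mdifferentiable_smoothFunction (f : C^∞⟮𝓘(ℝ, E), M; ℝ⟯) :
    MDifferentiable 𝓘(ℝ, E) 𝓘(ℝ, ℝ) f :=
  f.contMDiff.mdifferentiable (by simp)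

theorem dFun_algebraMap (r : ℝ) (p : M) (u : TangentSpace 𝓘(ℝ, E) p) :
    dFun (algebraMap ℝ C^∞⟮𝓘(ℝ, E), M; ℝ⟯ r) p u = 0 :=
  congrArg (fun L => L u) (mfderiv_const (I := 𝓘(ℝ, E)) (I' := 𝓘(ℝ, ℝ)) (x := p) (c := r))

variable [IsManifold 𝓘(ℝ, E) ∞ M]

theorem eq_of_mfderiv_eq_zero [PreconnectedSpace M] {f : M → ℝ}
    (hf : MDifferentiable 𝓘(ℝ, E) 𝓘(ℝ, ℝ) f)
    (hf' : ∀ (p : M) (u : TangentSpace 𝓘(ℝ, E) p), mfderiv 𝓘(ℝ, E) 𝓘(ℝ, ℝ) f p u = 0)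
    (p q : M) : f p = f q := by
  refine IsLocallyConstant.apply_eq_of_preconnectedSpace
    ((IsLocallyConstant.iff_eventually_eq f).2 fun c => ?_) p q
  set φ := extChartAt 𝓘(ℝ, E) c
  have hmd (y : E) (hy : y ∈ φ.target) : MDifferentiableAt 𝓘(ℝ, E) 𝓘(ℝ, E) φ.symm y :=
    (((contMDiffOn_extChartAt_symm (I := 𝓘(ℝ, E)) (n := ∞) c).contMDiffAt
      ((isOpen_extChartAt_target c).mem_nhds hy))).mdifferentiableAt (by simp)
  have hd : DifferentiableOn ℝ (f ∘ φ.symm) φ.target := fun y hy =>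
    ((hf _).comp y (hmd y hy)).differentiableAt.differentiableWithinAt
  have hd' : φ.target.EqOn (fderiv ℝ (f ∘ φ.symm)) 0 := fun y hy => by
    rw [← mfderiv_eq_fderiv, mfderiv_comp y (hf _) (hmd y hy)]
    ext u
    exact hf' _ _
  have ho := (isOpen_extChartAt_target c).isOpen_inter_preimage_of_fderiv_eq_zero hd hd' {f c}
  have hc : φ c ∈ φ.target ∩ (f ∘ φ.symm) ⁻¹' {f c} :=
    ⟨mem_extChartAt_target c, congrArg f (extChartAt_to_inv c)⟩
  filter_upwards [(continuousAt_extChartAt (I := 𝓘(ℝ, E)) c).preimage_mem_nhds (ho.mem_nhds hc),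
    extChartAt_source_mem_nhds (I := 𝓘(ℝ, E)) c] with q hq hqs
  have h : f (φ.symm (φ q)) = f c := hq.2
  rwa [φ.left_inv hqs] at h

/-- The linear map `f ↦ (d f, f p)`. -/
noncomputable def differentialAndValue (p : M) : C^∞⟮𝓘(ℝ, E), M; ℝ⟯ →ₗ[ℝ]
    ((q : M) → TangentSpace 𝓘(ℝ, E) q → ℝ) × ℝ where
  toFun f := (dFun f, f p)
  map_add' f g := by
    refine Prod.ext ?_ rfl
    funext q u
    exact congrArg (fun L => L u) (mfderiv_add (mdifferentiable_smoothFunction f q)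
      (mdifferentiable_smoothFunction g q))
  map_smul' r f := by
    refine Prod.ext ?_ rfl
    funext q u
    exact congrArg (fun L => L u) (const_smul_mfderiv (mdifferentiable_smoothFunction f q) r)

theorem differentialAndValue_injective [PreconnectedSpace M] (p : M) :
    Function.Injective (differentialAndValue (E := E) p) := by
  rw [injective_iff_map_eq_zero]
  intro f hf
  ext q
  rw [eq_of_mfderiv_eq_zero (mdifferentiable_smoothFunction f)
    (fun q u => congrFun (congrFun (congrArg Prod.fst hf) q) u) q p]
  exact congrArg Prod.snd hf

/-- The differential of a function and its value at one point determine the function on a connected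
manifold, so a multilinear alternating family of differentials and values at a point integrates to
a multilinear alternating family of functions as soon as each of its members does. -/
theorem exists_alternatingMap_primitive [PreconnectedSpace M] (p : M)
    {V ι : Type*} [AddCommGroup V] [Module ℝ V]
    (β : V [⋀^ι]→ₗ[ℝ] ((q : M) → TangentSpace 𝓘(ℝ, E) q → ℝ)) (c : V [⋀^ι]→ₗ[ℝ] ℝ)
    (h : ∀ m, ∃ f : C^∞⟮𝓘(ℝ, E), M; ℝ⟯, dFun f = β m) :
    ∃ f : V [⋀^ι]→ₗ[ℝ] C^∞⟮𝓘(ℝ, E), M; ℝ⟯, ∀ m, dFun (f m) = β m ∧ f m p = c m := by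
  have hr (m : ι → V) : (β.prod c) m ∈ (differentialAndValue (E := E) p).range := by
    obtain ⟨f, hf⟩ := h m
    -- shift the primitive `f` by a constant to get the value `c m` at `p`
    refine ⟨f + algebraMap ℝ _ (c m - f p), Prod.ext ?_ ?_⟩
    · refine Eq.trans ?_ hf
      funext q u
      have h0 := (differentialAndValue (E := E) p).map_add f (algebraMap ℝ _ (c m - f p))
      have h1 := congrFun (congrFun (congrArg Prod.fst h0) q) u
      exact h1.trans ((congrArg (dFun f q u + ·) (dFun_algebraMap _ q u)).trans (add_zero _))
    · exact add_sub_cancel (f p) (c m)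
  let e := LinearEquiv.ofInjective _ (differentialAndValue_injective (E := E) p)
  refine ⟨e.symm.toLinearMap.compAlternatingMap ((β.prod c).codRestrict _ hr), fun m => ?_⟩
  have he : differentialAndValue p (e.symm (((β.prod c).codRestrict _ hr) m)) = (β m, c m) :=
    congrArg Subtype.val (e.apply_symm_apply (((β.prod c).codRestrict _ hr) m))
  exact ⟨congrArg Prod.fst he, congrArg Prod.snd he⟩

end Global

/-! ### Moment maps and quotients -/

section Moment

variable {E : Type*} [NormedAddCommGroup E] [NormedSpace ℝ E]
  {M : Type*} [TopologicalSpace M] [ChartedSpace E M] [IsManifold 𝓘(ℝ, E) ∞ M]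
  {𝔤 : Type*} [LieRing 𝔤] [LieAlgebra ℝ 𝔤] {𝔥 : Type*} [AddCommGroup 𝔥] [Module ℝ 𝔥]
  {Ω : RoughForm E M 3} {v : 𝔤 →ₗ[ℝ] VectorFields E M} {L : LieTwoBrackets 𝔤 𝔥}

theorem omegaAt_apply (p : M) (x y z : 𝔤) :
    omegaAt Ω v p ![x, y, z] = Ω p ![v x p, v y p, v z p] := by
  change Ω p _ = Ω p _
  congr 1
  ext i; fin_cases i <;> rfl

/-- The quotient of `𝔥` by the kernel of `h ↦ f₁(h)(p)` is isomorphic to `ℝ`, and `f₂(·, ·)(p)`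
completes this to an `L_∞`-isomorphism. -/
theorem MomentMap.hasQuotientIsoOverId (μ : MomentMap Ω v L) (p : M)
    (hp : ¬ IsCECoboundary (omegaAt Ω v p)) :
    HasQuotientIsoOverId L (oneDimExtension (-(omegaAt Ω v p))) := by
  let ev : C^∞⟮𝓘(ℝ, E), M; ℝ⟯ →ₗ[ℝ] ℝ :=
    { toFun := fun f => f p, map_add' := fun _ _ => rfl, map_smul' := fun _ _ => rfl }
  let l : 𝔥 →ₗ[ℝ] ℝ := ev ∘ₗ μ.f₁𝔥
  let η : 𝔤 [⋀^Fin 2]→ₗ[ℝ] ℝ := ev.compAlternatingMap μ.f₂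
  have htri (x y z : 𝔤) : l (L.tri ![x, y, z]) + omegaAt Ω v p ![x, y, z] =
      η ![x, ⁅y, z⁆] - η ![y, ⁅x, z⁆] + η ![z, ⁅x, y⁆] := by
    have h := μ.f₁𝔥_tri x y z p
    rw [lInftyBracket₃, sub_neg_eq_add] at h
    rw [omegaAt_apply]
    exact h
  have hη (x y : 𝔤) : η ![x, y] = -η ![y, x] := by
    rw [← η.map_swap ![y, x] (i := 0) (j := 1) (by simp)]
    congr 1
    ext i; fin_cases i <;> rfl
  -- otherwise `η` would be a primitive of `ω_{3p}`
  have hl : l ≠ 0 := by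
    intro hl
    refine hp ⟨η, fun x y z => ?_⟩
    have h := htri x y z
    rw [hl, LinearMap.zero_apply, hη x, hη y, hη z] at h
    linarith
  have hact (x : 𝔤) (h : 𝔥) : l (L.act x h) = 0 := by
    have := μ.f₁𝔥_act x h
    simp [l, this]
  refine ⟨LinearMap.ker l, fun x k _ => hact x k, ⟨LinearMap.id, (LinearMap.ker l).liftQ l le_rfl,
    η, fun _ _ => rfl, fun x h => ?_, fun x y z => ?_⟩, ⟨Function.bijective_id, ?_, ?_⟩, rfl⟩
  · induction h using Submodule.Quotient.induction_on with
    | _ h => exact hact x h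
  · have h := htri x y z
    change l (L.tri ![x, y, z]) - -(omegaAt Ω v p ![x, y, z]) =
      η ![x, ⁅y, z⁆] - η ![y, ⁅x, z⁆] + η ![z, ⁅x, y⁆] + 0 - 0 + 0
    linarith
  · rw [← LinearMap.ker_eq_bot]
    exact Submodule.ker_liftQ_eq_bot _ _ _ le_rfl
  · rw [← LinearMap.range_eq_top, Submodule.range_liftQ]
    exact LinearMap.range_eq_top.2 (LinearMap.surjective hl)

theorem neg_interiorProduct_add (X Y : VectorFields E M) {k : ℕ} (Ω : RoughForm E M (k + 1)) :
    -interiorProduct (X + Y) Ω = -interiorProduct X Ω + -interiorProduct Y Ω := by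
  rw [← neg_add, neg_inj]
  funext p
  exact map_add (ContinuousAlternatingMap.curryLeft (E := E) (Ω p)) (X p) (Y p)

theorem smul_neg_interiorProduct (r : ℝ) (X : VectorFields E M) {k : ℕ}
    (Ω : RoughForm E M (k + 1)) : -interiorProduct (r • X) Ω = r • -interiorProduct X Ω := by
  rw [smul_neg, neg_inj]
  funext p
  exact map_smul (ContinuousAlternatingMap.curryLeft (E := E) (Ω p)) r (X p)

/-- The Hamiltonian 1-forms of the fields `v x` can be chosen to depend linearly on `x`, by
splitting the projection to `𝔤` of the space of pairs `(x, α)` with `d α = -i_{v x} Ω`. -/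
theorem IsHamiltonianAction.exists_linear_primitive (hv : IsHamiltonianAction Ω v) :
    ∃ f : 𝔤 →ₗ[ℝ] SmoothForm E M 1,
      ∀ x, IsHamiltonianVectorFieldOf Ω (v x) (f x : RoughForm E M 1) := by
  let S : Submodule ℝ (𝔤 × SmoothForm E M 1) :=
    { carrier := {a | IsHamiltonianVectorFieldOf Ω (v a.1) (a.2 : RoughForm E M 1)}
      zero_mem' := by
        obtain ⟨α, -, h⟩ := hv.hamiltonian 0
        -- `d (0 • α) = 0 • (-i_{v 0} Ω)`
        have h0 := h.smul 0
        rw [← smul_neg_interiorProduct, zero_smul, ← map_smul, zero_smul] at h0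
        exact h0
      add_mem' := fun {a b} ha hb => by
        have h := IsExtDeriv.add a.2.2 b.2.2 ha hb
        rw [← neg_interiorProduct_add, ← map_add] at h
        exact h
      smul_mem' := fun r a ha => by
        have h := IsExtDeriv.smul r ha
        rw [← smul_neg_interiorProduct, ← map_smul] at h
        exact h }
  obtain ⟨g, hg⟩ := LinearMap.exists_rightInverse_of_surjective
    (LinearMap.fst ℝ 𝔤 (SmoothForm E M 1) ∘ₗ S.subtype) (LinearMap.range_eq_top.2 fun x => by
      obtain ⟨α, hα, h⟩ := hv.hamiltonian x
      exact ⟨⟨(x, ⟨α, hα⟩), h⟩, rfl⟩)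
  refine ⟨LinearMap.snd ℝ 𝔤 (SmoothForm E M 1) ∘ₗ S.subtype ∘ₗ g, fun x => ?_⟩
  have h : (g x : 𝔤 × SmoothForm E M 1).1 = x := congrArg (fun f => f x) hg
  have h' := (g x).2
  change IsHamiltonianVectorFieldOf Ω (v (g x : 𝔤 × SmoothForm E M 1).1) _ at h'
  rwa [h] at h'

variable (𝔤) in
/-- The Lie bracket as an alternating map. -/
def lieAlternating : 𝔤 [⋀^Fin 2]→ₗ[ℝ] 𝔤 where
  toFun m := ⁅m 0, m 1⁆
  map_update_add' m i x y := by fin_cases i <;> simp [Function.update]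
  map_update_smul' m i r x := by fin_cases i <;> simp [Function.update]
  map_eq_zero_of_eq' m i j h hij := by
    have h01 : m 0 = m 1 := by fin_cases i <;> fin_cases j <;> simp_all
    rw [h01, lie_self]

/-- The value of `v x` at `q`, as a function of `x`. -/
noncomputable def evalField (v : 𝔤 →ₗ[ℝ] VectorFields E M) (q : M) : 𝔤 →ₗ[ℝ] E where
  toFun x := v x q
  map_add' x y := congrArg (fun X : VectorFields E M => X q) (map_add v x y)
  map_smul' r x := congrArg (fun X : VectorFields E M => X q) (map_smul v r x)

/-- The value of the 1-form `f x` on a tangent vector, as a function of `x`. -/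
noncomputable def evalForm (f : 𝔤 →ₗ[ℝ] SmoothForm E M 1) (q : M)
    (u : TangentSpace 𝓘(ℝ, E) q) : 𝔤 →ₗ[ℝ] ℝ where
  toFun x := (f x : RoughForm E M 1) q ![u]
  map_add' x y := by rw [map_add]; rfl
  map_smul' r x := by rw [map_smul]; rfl

/-- The differential which `f₂(x, y)` has to have: `f₁([x, y]) - Ω(v_x, v_y, ·)`, as an alternating
map in `x` and `y`. The second term is written as `Ω(·, v_x, v_y)`. -/
noncomputable def momentDifferential (Ω : RoughForm E M 3) (v : 𝔤 →ₗ[ℝ] VectorFields E M)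
    (f : 𝔤 →ₗ[ℝ] SmoothForm E M 1) :
    𝔤 [⋀^Fin 2]→ₗ[ℝ] ((q : M) → TangentSpace 𝓘(ℝ, E) q → ℝ) :=
  AlternatingMap.pi fun q => AlternatingMap.pi fun u =>
    (evalForm f q u).compAlternatingMap (lieAlternating 𝔤) -
      (ContinuousAlternatingMap.curryLeft (E := E) (Ω q) u).toAlternatingMap.compLinearMap
        (evalField v q)

theorem momentDifferential_apply (f : 𝔤 →ₗ[ℝ] SmoothForm E M 1) (m : Fin 2 → 𝔤) (q : M)
    (u : TangentSpace 𝓘(ℝ, E) q) :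
    momentDifferential Ω v f m q u = (f ⁅m 0, m 1⁆ : RoughForm E M 1) q ![u]
      - lInftyBracket₂ Ω (v (m 0)) (v (m 1)) q u := by
  refine congrArg₂ (fun a b : ℝ => a - b) rfl ?_
  have h : Ω q ![u, v (m 0) q, v (m 1) q] = Ω q ![v (m 0) q, v (m 1) q, u] := by
    rw [Ω.swap_left q u, Ω.swap_right q _ u, neg_neg]
  rw [lInftyBracket₂, ← h]
  change Ω q _ = Ω q _
  congr 1
  ext i; fin_cases i <;> rfl

/-- If `H¹(M) = 0`, an `L_∞`-isomorphism from a quotient of `L` to `ℝ[1] ⊕ 𝔤` extends to a moment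
map: `f₁` is constant on `𝔥`, and `f₂` is normalized at `p` by the second component of the
isomorphism. -/
theorem IsHamiltonianAction.exists_momentMap [CompleteSpace E] [PreconnectedSpace M]
    (hΩ : IsTwoPlectic Ω) (hv : IsHamiltonianAction Ω v) (p : M)
    (hM : FirstDeRhamVanishes E M)
    (hL : HasQuotientIsoOverId L (oneDimExtension (-(omegaAt Ω v p)))) :
    Nonempty (MomentMap Ω v L) := by
  obtain ⟨K, hK, F, -, hF⟩ := hL
  obtain ⟨f, hf⟩ := hv.exists_linear_primitive
  have hclosed (m : Fin 2 → 𝔤) :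
      ∃ g : C^∞⟮𝓘(ℝ, E), M; ℝ⟯, dFun g = momentDifferential Ω v f m := by
    set η : RoughForm E M 1 := interiorProduct (v (m 1)) (interiorProduct (v (m 0)) Ω)
    have hη : η ∈ SmoothForm E M 1 :=
      interiorProduct_mem_smoothForm _ (interiorProduct_mem_smoothForm _ hΩ.smooth)
    have hdη : IsExtDeriv η (-interiorProduct (v ⁅m 0, m 1⁆) Ω) :=
      hΩ.isExtDeriv_interiorProduct (hv.hamiltonian _) (hv.hamiltonian _) (hv.map_lie _ _)
    -- the differentials of `f₁([x, y])` and of `Ω(v_x, v_y, ·)` agree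
    have hd := (hf ⁅m 0, m 1⁆).add (f ⁅m 0, m 1⁆).2 ((SmoothForm E M 1).smul_mem (-1) hη)
      (hdη.smul (-1))
    have hz : -interiorProduct (v ⁅m 0, m 1⁆) Ω + (-1 : ℝ) • -interiorProduct (v ⁅m 0, m 1⁆) Ω =
        0 := by
      simp
    rw [hz, neg_one_smul] at hd
    obtain ⟨g, hg⟩ := hM _ ((SmoothForm E M 1).add_mem (f ⁅m 0, m 1⁆).2
      ((SmoothForm E M 1).neg_mem hη)) hd
    refine ⟨g, ?_⟩
    funext q u
    rw [hg, momentDifferential_apply]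
    exact (sub_eq_add_neg _ _).symm
  obtain ⟨f₂, hf₂⟩ := exists_alternatingMap_primitive p (momentDifferential Ω v f) F.f₂ hclosed
  have hd (x y : 𝔤) (q : M) (u : TangentSpace 𝓘(ℝ, E) q) : dFun (f₂ ![x, y]) q u =
      (f ⁅x, y⁆ : RoughForm E M 1) q ![u] - lInftyBracket₂ Ω (v x) (v y) q u :=
    (congrFun (congrFun (hf₂ ![x, y]).1 q) u).trans (momentDifferential_apply f ![x, y] q u)
  refine ⟨f, Algebra.linearMap ℝ _ ∘ₗ F.f₁ ∘ₗ K.mkQ, f₂, hf, fun h => dFun_algebraMap _, hd,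
    fun x h => ?_, fun x y z q => ?_⟩
  · have h0 : F.f₁ (K.mkQ (L.act x h)) = 0 := F.map_act x (K.mkQ h)
    exact (congrArg (algebraMap ℝ _) h0).trans (map_zero _)
  -- the last equation: the difference of its sides is constant, and known at `p`
  · set G : M → ℝ := fun q => f₂ ![x, ⁅y, z⁆] q - f₂ ![y, ⁅x, z⁆] q + f₂ ![z, ⁅x, y⁆] q
      - Ω q ![v x q, v y q, v z q] with hG
    have hGd : ∀ q, HasMFDerivAt 𝓘(ℝ, E) 𝓘(ℝ, ℝ) G q 0 := fun q => by
      have h1 := (mdifferentiable_smoothFunction (f₂ ![x, ⁅y, z⁆]) q).hasMFDerivAt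
      have h2 := (mdifferentiable_smoothFunction (f₂ ![y, ⁅x, z⁆]) q).hasMFDerivAt
      have h3 := (mdifferentiable_smoothFunction (f₂ ![z, ⁅x, y⁆]) q).hasMFDerivAt
      obtain ⟨h4, h5⟩ := hΩ.mfderiv_apply_three (hv.hamiltonian x) (hv.hamiltonian y)
        (hv.hamiltonian z) (hv.map_lie x y) (hv.map_lie z y) (hv.map_lie z x) q
      have h := ((h1.sub h2).add h3).sub h4.hasMFDerivAt
      refine h.congr_mfderiv ?_
      ext u
      have hj : evalForm f q u ⁅x, ⁅y, z⁆⁆ - evalForm f q u ⁅y, ⁅x, z⁆⁆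
          + evalForm f q u ⁅z, ⁅x, y⁆⁆ = 0 := by
        rw [← map_sub, ← map_add, leibniz_lie x y z, ← lie_skew z ⁅x, y⁆]
        simp
      simp only [evalForm, LinearMap.coe_mk, AddHom.coe_mk] at hj
      have e1 := hd x ⁅y, z⁆ q u
      have e2 := hd y ⁅x, z⁆ q u
      have e3 := hd z ⁅x, y⁆ q u
      let D : ℝ := mfderiv 𝓘(ℝ, E) 𝓘(ℝ, ℝ) (fun q => Ω q ![v x q, v y q, v z q]) q u
      have e4 : D = Ω q ![v ⁅x, y⁆ q, v z q, u] + Ω q ![v x q, v ⁅z, y⁆ q, u]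
        + Ω q ![v ⁅z, x⁆ q, v y q, u] := h5 u
      simp only [lInftyBracket₂] at e1 e2 e3
      change dFun (f₂ ![x, ⁅y, z⁆]) q u - dFun (f₂ ![y, ⁅x, z⁆]) q u + dFun (f₂ ![z, ⁅x, y⁆]) q u
        - D = 0
      rw [e1, e2, e3, e4]
      have hs (a b : 𝔤) (w : TangentSpace 𝓘(ℝ, E) q) :
          Ω q ![v ⁅a, b⁆ q, w, u] = -Ω q ![v ⁅b, a⁆ q, w, u] := by
        have h : evalField v q ⁅a, b⁆ = -evalField v q ⁅b, a⁆ := by rw [← lie_skew, map_neg]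
        have h' := congrArg (fun t => ContinuousAlternatingMap.curryLeft (E := E) (Ω q) t ![w, u]) h
        rw [map_neg] at h'
        exact h'
      have n1 := Ω.swap_left q (v x q) (v ⁅z, y⁆ q) u
      have n1' := Ω.swap_left q (v x q) (v ⁅y, z⁆ q) u
      have n2 := Ω.swap_left q (v y q) (v ⁅x, z⁆ q) u
      have n4 := hs z y (v x q)
      have n5 := hs z x (v y q)
      have n3 := Ω.swap_left q (v z q) (v ⁅x, y⁆ q) u
      linarith
    have hGc : G q = G p :=
      eq_of_mfderiv_eq_zero (fun q => (hGd q).mdifferentiableAt)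
        (fun q u => by rw [(hGd q).mfderiv]; rfl) q p
    have ht : F.f₁ (K.mkQ (L.tri ![x, y, z])) - -omegaAt Ω v p ![F.f₀ x, F.f₀ y, F.f₀ z] =
      F.f₂ ![x, ⁅y, z⁆] - F.f₂ ![y, ⁅x, z⁆] + F.f₂ ![z, ⁅x, y⁆] + 0 - 0 + 0 := F.map_tri x y z
    rw [hF, LinearMap.id_apply, LinearMap.id_apply, LinearMap.id_apply, omegaAt_apply] at ht
    simp only [hG, (hf₂ _).2] at hGc
    change F.f₁ (K.mkQ (L.tri ![x, y, z])) - -Ω q ![v x q, v y q, v z q] = _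
    linarith

end Moment

end TwoPlectic

theorem mainTheorem9
    {E : Type*} [NormedAddCommGroup E] [NormedSpace ℝ E] [FiniteDimensional ℝ E]
    {M : Type*} [TopologicalSpace M] [ChartedSpace E M] [IsManifold 𝓘(ℝ, E) ∞ M]
    [T2Space M] [SecondCountableTopology M] [ConnectedSpace M]
    {𝔤 : Type*} [LieRing 𝔤] [LieAlgebra ℝ 𝔤] [FiniteDimensional ℝ 𝔤]
    {𝔥 : Type*} [AddCommGroup 𝔥] [Module ℝ 𝔥] [FiniteDimensional ℝ 𝔥]
    (Ω : TwoPlectic.RoughForm E M 3) (hΩ : TwoPlectic.IsTwoPlectic Ω)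
    (v : 𝔤 →ₗ[ℝ] TwoPlectic.VectorFields E M) (hv : TwoPlectic.IsHamiltonianAction Ω v)
    (L : TwoPlectic.LieTwoBrackets 𝔤 𝔥) (hL : L.IsLieTwoAlgebra)
    (p : M) (hp : ¬ TwoPlectic.IsCECoboundary (TwoPlectic.omegaAt Ω v p)) :
    (Nonempty (TwoPlectic.MomentMap Ω v L) →
      TwoPlectic.HasQuotientIsoOverId L
        (TwoPlectic.oneDimExtension (-(TwoPlectic.omegaAt Ω v p)))) ∧
    (TwoPlectic.FirstDeRhamVanishes E M →
      TwoPlectic.HasQuotientIsoOverId L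
        (TwoPlectic.oneDimExtension (-(TwoPlectic.omegaAt Ω v p))) →
      Nonempty (TwoPlectic.MomentMap Ω v L)) := by
  have : CompleteSpace E := FiniteDimensional.complete ℝ E
  exact ⟨fun ⟨μ⟩ => μ.hasQuotientIsoOverId p hp, fun hM h => hv.exists_momentMap hΩ p hM h⟩
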